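/- \textbf{Setting.} Let $C$ be a measurable space of colors, and let $\mu_i$ be a finite measure on $C$ for every dimension $i$. For every finite set $D$ of dimensions let $w_D : C^D\to[0,\infty)$ be a measurable unnormalized density with respect to the product measure $\mu_D=\prod_{i\in D}\mu_i$, and for every $d\in D$ let a factorization $$w_D(x)=w_1(x(d))\,w_{D\setminus\{d\}}(x(D\setminus\{d\}))\,w_{12}(x),\qquad x\in C^D,$$ into nonnegative measurable factors be given, with a known constant $M>0$ such that $w_{12}\le M$, and with $0<\int w_1\,d\mu_d<\infty$ ($w_1$, $w_{12}$, $M$ may depend on $D$ and $d$). \textbf{Procedure.} Fix a rule that picks an element $d$ of each nonempty set $S$ (given $D$). For finite sets $S\subseteq D$, the procedure $\mathrm{PRAR}(S,D)$ outputs a random pair $[X(S'),S']$ as follows. If $S=\emptyset$, output $[\emptyset,\emptyset]$. Otherwise let $d$ be the chosen element of $S$, draw $X(d)$ from density $w_1$ with respect to $\mu_d$, and independently draw $U$ uniformly from $[0,1]$. \begin{itemize} \item If $U\le \inf_{x\in C^D,\;x(d)=X(d)} w_{12}(x)/M$, draw $[X(S''),S'']\leftarrow\mathrm{PRAR}(S\setminus\{d\},D\setminus\{d\})$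 and output $[X(S''\cup\{d\}),S''\cup\{d\}]$. \item Otherwise let $D_3\subseteq D\setminus\{d\}$ be the smallest set such that, given the value $X(d)$, the coordinates in $D_3$ determine the value of $w_{12}$. Draw $[X(S''),S'']\leftarrow\mathrm{PRAR}(D_3\cup(S\setminus\{d\}),D\setminus\{d\})$. If $U\le w_{12}(X(\{d\}\cup D_3))/M$, output $[X(S''\cup\{d\}),S''\cup\{d\}]$; else output the result of a new independent run of $\mathrm{PRAR}(S,D)$. \end{itemize} All random draws are fresh and independent. (Assume that the infimum above and the set $D_3$ are measurable functions of the value $X(d)$.) \textbf{Lemma.} Let $S\subseteq D$ be finite sets of dimensions with $\int w_D\,d\mu_D>0$, and suppose that $\mathrm{PRAR}(S,D)$ terminates with probability $1$, with output $[X(S'),S']$. Then, with probability $1$, $S\subseteq S'$, and $X(S)$ has the same joint distribution as the coordinates in $S$ of $X^*$, where $X^*$ is a complete draw from the density $w_D$ with respect to $\mu_D$ over the dimensions $D$; that is, for every measurable $B\subseteq C^S$, $$\mathbb P\bigl(S\subseteq S',\ X(S)\in B\bigr)=\frac{\int \mathbf 1\{x(S)\in B\}\,w_D(x)\,d\mu_D(x)}{\int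 w_D\,d\mu_D}.$$ -/

import Mathlib

open MeasureTheory
open scoped NNReal ENNReal

noncomputable section

namespace PRAR

variable {ι C : Type*} [DecidableEq ι]

/-- `Determines D d f c T`: once the coordinate `d` is fixed to the value `c`, the coordinates
in `T` determine the value of `f : C^D → [0,∞)`. -/
def Determines (D : Finset ι) (d : ι) (f : (D → C) → ℝ≥0) (c : C) (T : Finset ι) : Prop :=
  ∀ x y : D → C, (∀ i : D, i.1 = d → x i = c ∧ y i = c) → (∀ i : D, i.1 ∈ T → x i = y i) →
    f x = f y

open scoped Classical in
/-- The smallest set `T ⊆ D \ {d}` of coordinates such that `X(d) = c` together with `X(T)`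
determines `f(X)`. That it is indeed the smallest one is proved below. -/
def determiningSet (D : Finset ι) (d : ι) (f : (D → C) → ℝ≥0) (c : C) : Finset ι :=
  (D.erase d).filter fun e => ∀ T ⊆ D.erase d, Determines D d f c T → e ∈ T

theorem determiningSet_subset (D : Finset ι) (d : ι) (f : (D → C) → ℝ≥0) (c : C) :
    determiningSet D d f c ⊆ D.erase d := by
  classical
  exact Finset.filter_subset _ _

theorem Determines.inter {D : Finset ι} {d : ι} {f : (D → C) → ℝ≥0} {c : C} {T U : Finset ι}
    (hT : Determines D d f c T) (hU : Determines D d f c U) : Determines D d f c (T ∩ U) := by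
  intro x y hd hxy
  have h1 : f x = f (fun i => if i.1 ∈ T then x i else y i) := by
    refine hT _ _ (fun i hi => ⟨(hd i hi).1, ?_⟩) (fun i hi => by simp [hi])
    by_cases h : i.1 ∈ T
    · simp [h, (hd i hi).1]
    · simp [h, (hd i hi).2]
  have h2 : f (fun i => if i.1 ∈ T then x i else y i) = f y := by
    refine hU _ _ (fun i hi => ⟨?_, (hd i hi).2⟩) (fun i hi => ?_)
    · by_cases h : i.1 ∈ T
      · simp [h, (hd i hi).1]
      · simp [h, (hd i hi).2]
    · by_cases h : i.1 ∈ T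
      · simp [h, hxy i (Finset.mem_inter.2 ⟨h, hi⟩)]
      · simp [h]
  exact h1.trans h2

/-- The set `determiningSet D d f c` is the least subset of `D \ {d}` that, together with
`X(d) = c`, determines `f`. -/
theorem determiningSet_isLeast (D : Finset ι) (d : ι) (f : (D → C) → ℝ≥0) (c : C) :
    IsLeast {T : Finset ι | T ⊆ D.erase d ∧ Determines D d f c T} (determiningSet D d f c) := by
  classical
  refine ⟨⟨determiningSet_subset D d f c, ?_⟩, fun T hT e he =>
    (Finset.mem_filter.1 he).2 T hT.1 hT.2⟩
  have key : ∀ F : Finset (Finset ι), (∀ T ∈ F, Determines D d f c T) →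
      Determines D d f c ((D.erase d).filter fun e => ∀ T ∈ F, e ∈ T) := by
    intro F
    induction F using Finset.induction_on with
    | empty =>
      intro _ x y hd hxy
      congr 1
      funext i
      by_cases h : i.1 = d
      · rw [(hd i h).1, (hd i h).2]
      · exact hxy i (by simp [h, i.2])
    | insert T F _ ih =>
      intro h
      have := (h T (by simp)).inter (ih fun U hU => h U (by simp [hU]))
      convert this using 1
      ext e
      simp only [Finset.mem_filter, Finset.mem_inter, Finset.mem_insert, forall_eq_or_imp]
      tauto
  have := key ((D.erase d).powerset.filter fun T => Determines D d f c T)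
    (fun T hT => (Finset.mem_filter.1 hT).2)
  convert this using 1
  ext e
  simp [determiningSet, and_imp]

/-- `min_{x(D \ {d})} f(c, x(D \ {d}))`: the infimum of `f` over all states whose coordinate `d`
is equal to `c`. -/
def minGiven (D : Finset ι) (d : ι) (f : (D → C) → ℝ≥0) (c : C) : ℝ≥0 :=
  ⨅ x : {x : D → C // ∀ i : D, i.1 = d → x i = c}, f x.1

variable [MeasurableSpace C]

/-- The data on which the procedure runs. For every finite set `D` of dimensions there is an
unnormalized density `w D` on `C^D` with respect to the product of the measures `μ i`, `i ∈ D`,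
and for every `d ∈ D` a factorization
`w_D(x) = w₁(x(d)) · w_{D \ {d}}(x(D \ {d})) · w₁₂(x)` with a known bound `w₁₂ ≤ M`. -/
structure Model (μ : ι → Measure C) where
  /-- the unnormalized density over the dimensions `D` -/
  w : (D : Finset ι) → (D → C) → ℝ≥0
  /-- the factor `w₁` belonging to the splitting of `D` into `{d}` and `D \ {d}` -/
  w₁ : (D : Finset ι) → (d : ι) → C → ℝ≥0
  /-- the factor `w₁₂` belonging to the splitting of `D` into `{d}` and `D \ {d}` -/
  w₁₂ : (D : Finset ι) → (d : ι) → (D → C) → ℝ≥0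
  /-- the bound for the factor `w₁₂` -/
  M : (D : Finset ι) → (d : ι) → ℝ≥0
  factor : ∀ (D : Finset ι) (d : ι) (hd : d ∈ D) (x : D → C),
    w D x = w₁ D d (x ⟨d, hd⟩) * w (D.erase d) (Finset.restrict₂ (π := fun _ => C) (Finset.erase_subset d D) x)
      * w₁₂ D d x
  M_pos : ∀ (D : Finset ι), ∀ d ∈ D, 0 < M D d
  le_M : ∀ (D : Finset ι), ∀ d ∈ D, ∀ x : D → C, w₁₂ D d x ≤ M D d
  /-- `w₁` can be normalized, so that one can draw from it -/
  w₁_ne_zero : ∀ (D : Finset ι), ∀ d ∈ D, ∫⁻ c, (w₁ D d c : ℝ≥0∞) ∂(μ d) ≠ 0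
  w₁_ne_top : ∀ (D : Finset ι), ∀ d ∈ D, ∫⁻ c, (w₁ D d c : ℝ≥0∞) ∂(μ d) ≠ ∞
  measurable_w : ∀ D : Finset ι, Measurable (w D)
  measurable_w₁ : ∀ (D : Finset ι), ∀ d ∈ D, Measurable (w₁ D d)
  measurable_w₁₂ : ∀ (D : Finset ι), ∀ d ∈ D, Measurable (w₁₂ D d)
  /-- the minimum to which the procedure compares depends measurably on `X(d)` -/
  measurable_minGiven : ∀ (D : Finset ι), ∀ d ∈ D, Measurable (minGiven D d (w₁₂ D d))
  /-- the set `D₃` which the procedure queries depends measurably on `X(d)` -/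
  measurableSet_determiningSet : ∀ (D : Finset ι), ∀ d ∈ D, ∀ e : ι,
    MeasurableSet {c : C | e ∈ determiningSet D d (w₁₂ D d) c}

/-- An output `[X(S'), S']`: the coordinate `i` is mapped to `Sum.inl c` if `i ∈ S'` and
`X(i) = c`, and to `Sum.inr ()` if `i ∉ S'`. -/
abbrev Output (ι C : Type*) : Type _ := ι → C ⊕ Unit

/-- The output `[∅, ∅]`. -/
def Output.empty : Output ι C := fun _ => Sum.inr ()

/-- `[X(S''), S'']` together with `X(d) = c`, that is, `[X(S'' ∪ {d}), S'' ∪ {d}]`. -/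
def Output.record (d : ι) (c : C) (o : Output ι C) : Output ι C :=
  Function.update o d (Sum.inl c)

namespace Model

variable {μ : ι → Measure C} (P : Model μ)

/-- The law of a draw from the density `w₁` with respect to `μ d`. -/
def drawLaw (D : Finset ι) (d : ι) : Measure C :=
  (∫⁻ c, (P.w₁ D d c : ℝ≥0∞) ∂(μ d))⁻¹ • (μ d).withDensity fun c => (P.w₁ D d c : ℝ≥0∞)

/-- The set `D₃` for the value `X(d) = c`. -/
def queried (D : Finset ι) (d : ι) (c : C) : Finset ι :=
  determiningSet D d (P.w₁₂ D d) c

open scoped Classical in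
/-- The value `w₁₂(X({d} ∪ D₃))` for `X(d) = c` and the reported `X(S'')` given by `o`, where
`D₃ ⊆ S''`. The coordinates outside `D₃` do not matter; they are filled in by `c`, which is also
the value at `d`. -/
def interaction (D : Finset ι) (d : ι) (c : C) (o : Output ι C) : ℝ≥0 :=
  P.w₁₂ D d fun i => if i.1 ∈ P.queried D d c then Sum.elim id (fun _ => c) (o i) else c

open scoped Classical in
/-- The law of the output of the procedure on input `(S, D)`, restricted to the event that the
procedure terminates with fewer than `n` nested levels of calls. It is a measure of mass at most
one, and it increases with `n`. The rule `sel` tells which element `sel S D` of `S` is taken as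
`d`. -/
def law (sel : Finset ι → Finset ι → ι) : ℕ → Finset ι → Finset ι → Measure (Output ι C)
  | 0, _, _ => 0
  | n + 1, S, D =>
    if S = ∅ then Measure.dirac Output.empty
    else
      let d := sel S D
      -- draw `X(d) = c` from `w₁`, and `U = u` uniformly from `[0,1]`
      (P.drawLaw D d).bind fun c => (volume.restrict (Set.Icc (0 : ℝ) 1)).bind fun u =>
        if u ≤ (minGiven D d (P.w₁₂ D d) c / P.M D d : ℝ≥0) then
          -- accept at once, and draw the rest
          (law sel n (S.erase d) (D.erase d)).map (Output.record d c)
        else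
          -- query `D₃` and the rest of `S`
          (law sel n (S.erase d ∪ P.queried D d c) (D.erase d)).bind fun o =>
            if u ≤ (P.interaction D d c o / P.M D d : ℝ≥0) then
              Measure.dirac (Output.record d c o)
            else
              law sel n S D

/-- The probability that the procedure terminates on input `(S, D)` with an output in `B`: the
increasing limit of the probabilities that it does so with fewer than `n` nested levels of
calls. -/
def outputProb (sel : Finset ι → Finset ι → ι) (S D : Finset ι) (B : Set (Output ι C)) : ℝ≥0∞ :=
  ⨆ n : ℕ, P.law sel n S D B

/-- The procedure terminates with probability one on input `(S, D)`. -/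
def TerminatesAS (sel : Finset ι → Finset ι → ι) (S D : Finset ι) : Prop :=
  P.outputProb sel S D Set.univ = 1

/-- The normalizing constant of the density `w` over the dimensions `D`. -/
def partitionFunction (D : Finset ι) : ℝ≥0∞ :=
  ∫⁻ x, (P.w D x : ℝ≥0∞) ∂(Measure.pi fun i : D => μ i)

/-- The law of an exact draw from the density `w` with respect to `μ` over the dimensions `D`. -/
def exactLaw (D : Finset ι) : Measure (D → C) :=
  (P.partitionFunction D)⁻¹ •
    (Measure.pi fun i : D => μ i).withDensity fun x => (P.w D x : ℝ≥0∞)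

end Model

end PRAR

end

/-!
The proof bounds the output from above and lets the total mass do the rest. Cut the recursion off
at `n` nested levels. Then for every `f ≥ 0` that depends only on the coordinates in `S`, the
integral of `f` against the law of the truncated output is at most its expectation under an exact
draw from `w_D` (`Model.lintegral_law_le`). In particular an event that concerns only the
coordinates in `S` and its complement are both dominated by their exact probabilities. If the
procedure terminates almost surely, both families of bounds add up to one, so the bounds for the
event are attained in the limit. Almost sure termination of the recursive calls is never needed,
and neither is a limit of the recursion itself.

The bound is proved by induction on `n`. Replace every recursive call by the exact draw that
dominates it. For the two calls on `D \ {d}` this is possible since the recorded coordinates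
`S \ {d}` and the queried coordinates determine all that is used of their outputs
(`Model.interaction_ofState`). For the rerun on `(S, D)` it turns the contribution into the target
expectation `E` of `f`. Since the minimum of `w₁₂(x)` for given `x(d)` is at most `w₁₂(x)`, an
immediate acceptance is an acceptance after the query too. What remains is one step of rejection
sampling: a proposal `x` has density proportional to `w₁(x(d)) w_{D \ {d}}(x(D \ {d}))` and is
accepted with probability `w₁₂(x) / M`. The accepted proposals have density proportional to `w_D`,
hence contribute `r E`, where `r` is the probability of acceptance; the rejected ones contribute
`(1 - r) E` (`Model.lintegral_accept_add_reject`).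
-/

noncomputable section

namespace PRAR

/-! ### States and outputs -/

variable {ι C : Type*} [DecidableEq ι]

/-- The state on `D` with value `c` at `d` that agrees with `y` on `D \ {d}`. -/
def glue {D : Finset ι} {d : ι} (c : C) (y : ↥(D.erase d) → C) : D → C :=
  fun i => if h : i.1 = d then c else y ⟨i.1, Finset.mem_erase.2 ⟨h, i.2⟩⟩

theorem glue_self {D : Finset ι} {d : ι} (hd : d ∈ D) (c : C)
    (y : ↥(D.erase d) → C) : glue c y ⟨d, hd⟩ = c := by
  simp [glue]

theorem restrict₂_glue {D : Finset ι} {d : ι} (c : C) (y : ↥(D.erase d) → C) :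
    Finset.restrict₂ (π := fun _ => C) (Finset.erase_subset d D) (glue c y) = y := by
  funext i
  simp [glue, (Finset.mem_erase.1 i.2).1]

/-- The output that reports the state `x` on `D` and nothing else. -/
def Output.ofState {D : Finset ι} (x : D → C) : Output ι C :=
  fun i => if h : i ∈ D then Sum.inl (x ⟨i, h⟩) else Sum.inr ()

theorem Output.ofState_glue {D : Finset ι} {d : ι} (hd : d ∈ D) (c : C)
    (y : ↥(D.erase d) → C) :
    Output.ofState (glue c y) = Output.record d c (Output.ofState y) := by
  funext i
  by_cases hi : i = d
  · subst hi
    simp [Output.ofState, Output.record, hd, glue]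
  · simp [Output.ofState, Output.record, hi, glue]

omit [DecidableEq ι] in
theorem minGiven_le {D : Finset ι} {d : ι} (hd : d ∈ D) (f : (D → C) → ℝ≥0) (x : D → C) :
    minGiven D d f (x ⟨d, hd⟩) ≤ f x := by
  refine ciInf_le (OrderBot.bddBelow _)
    (⟨x, ?_⟩ : {z : D → C // ∀ i : D, i.1 = d → z i = x ⟨d, hd⟩})
  rintro ⟨i, hi⟩ rfl
  rfl

variable [MeasurableSpace C]

theorem measurable_glue {D : Finset ι} {d : ι} :
    Measurable fun p : C × (↥(D.erase d) → C) => (glue p.1 p.2 : D → C) := by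
  refine measurable_pi_lambda _ fun i => ?_
  by_cases h : i.1 = d
  · simpa [glue, h] using measurable_fst
  · simp only [glue, h, dite_false]
    exact (measurable_pi_apply _).comp measurable_snd

theorem Output.measurable_ofState {D : Finset ι} :
    Measurable (Output.ofState : (D → C) → Output ι C) := by
  refine measurable_pi_lambda _ fun i => ?_
  by_cases h : i ∈ D
  · simp only [Output.ofState, h, dite_true]
    exact measurable_inl.comp (measurable_pi_apply _)
  · simp [Output.ofState, h]

theorem Output.measurable_record (d : ι) (c : C) :
    Measurable (Output.record d c : Output ι C → Output ι C) :=
  measurable_update_left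

/-- Fubini's theorem, with the coordinate `d` split off. -/
theorem lintegral_pi_eq_lintegral_glue (μ : ι → Measure C) [∀ i, IsFiniteMeasure (μ i)]
    {D : Finset ι} {d : ι} (hd : d ∈ D) {g : (D → C) → ℝ≥0∞} (hg : Measurable g) :
    ∫⁻ x, g x ∂(Measure.pi fun i : D => μ i)
      = ∫⁻ c, ∫⁻ y, g (glue c y)
          ∂(Measure.pi fun i : (D.erase d : Finset ι) => μ i) ∂(μ d) := by
  rcases isEmpty_or_nonempty C with hC | ⟨⟨c₀⟩⟩
  · have : IsEmpty (D → C) := ⟨fun x => hC.false (x ⟨d, hd⟩)⟩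
    simp
  have h := lmarginal_erase (X := fun _ : ι => C) (μ := μ) (s := D)
    (fun z => g (Finset.restrict D z)) (hg.comp (Finset.measurable_restrict D)) hd (fun _ => c₀)
  simp only [lmarginal] at h
  convert h using 5 with y c y
  · funext i
    simp [Function.updateFinset]
  · congr 1
    funext i
    by_cases hi : i.1 = d
    · simp [Function.updateFinset, glue, hi]
    · simp [Function.updateFinset, glue, hi]

/-- The event that the procedure reports a state in `B` on the coordinates in `S`. -/
def reported {S : Finset ι} (B : Set (S → C)) : Set (Output ι C) :=
  {o | ∃ x ∈ B, ∀ s : S, o s = Sum.inl (x s)}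

omit [DecidableEq ι] in
theorem measurableSet_reported {S : Finset ι} {B : Set (S → C)} (hB : MeasurableSet B) :
    MeasurableSet (reported B : Set (Output ι C)) := by
  rcases isEmpty_or_nonempty C with hC | ⟨⟨c₀⟩⟩
  · have : Subsingleton (Output ι C) := ⟨fun o o' => funext fun i => by
      rcases o i with c | u
      · exact hC.elim c
      · rcases o' i with c | u'
        · exact hC.elim c
        · rfl⟩
    exact Subsingleton.measurableSet
  have h : (reported B : Set (Output ι C))
      = (⋂ s : S, {o | o s ∈ Set.range Sum.inl})
        ∩ (fun o (s : S) => Sum.elim id (fun _ => c₀) (o s)) ⁻¹' B := by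
    ext o
    simp only [reported, Set.mem_ofPred_eq, Set.mem_inter_iff, Set.mem_iInter, Set.mem_range,
      Set.mem_preimage]
    constructor
    · rintro ⟨x, hx, h⟩
      exact ⟨fun s => ⟨x s, (h s).symm⟩, by simpa [h] using hx⟩
    · rintro ⟨h, hB⟩
      choose x hx using h
      exact ⟨x, by simpa [← hx] using hB, fun s => (hx s).symm⟩
  rw [h]
  refine (MeasurableSet.iInter fun s : S =>
    measurable_pi_apply s.1 measurableSet_range_inl).inter
    (measurable_pi_lambda _ (fun s => ?_) hB)
  exact (Measurable.sumElim measurable_id measurable_const).comp (measurable_pi_apply _)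

omit [MeasurableSpace C] in
theorem ofState_mem_reported {S D : Finset ι} (hSD : S ⊆ D) (B : Set (S → C)) (x : D → C) :
    Output.ofState x ∈ (reported B : Set (Output ι C))
      ↔ Finset.restrict₂ (π := fun _ => C) hSD x ∈ B := by
  constructor
  · rintro ⟨y, hy, h⟩
    convert hy using 1
    funext s
    simpa [Output.ofState, hSD s.2] using h s
  · exact fun h => ⟨_, h, fun s => by simp [Output.ofState, hSD s.2]⟩

omit [DecidableEq ι] [MeasurableSpace C] in
theorem dependsOn_reported {S : Finset ι} (B : Set (S → C)) :
    DependsOn (fun o : Output ι C => o ∈ reported B) (S : Set ι) := by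
  intro o o' h
  simp only [reported, Set.mem_ofPred_eq, eq_iff_iff]
  refine exists_congr fun x => and_congr_right fun _ => forall_congr' fun s => ?_
  rw [h s s.2]

/-! ### One step of rejection sampling -/

/-- A uniform `U` lies below `a` with probability `a`. -/
theorem lintegral_uniform_ite {a : ℝ≥0} (ha : a ≤ 1) (F E : ℝ≥0∞) :
    ∫⁻ u in Set.Icc (0 : ℝ) 1, (if u ≤ a then F else E) = a * F + (1 - a) * E := by
  have h : (fun u : ℝ => if u ≤ a then F else E)
      = fun u => (Set.Iic (a : ℝ)).indicator (fun _ => F) u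
        + (Set.Ioi (a : ℝ)).indicator (fun _ => E) u := by
    funext u
    by_cases hu : u ≤ a
    · simp [hu, not_lt.2 hu]
    · simp [hu, not_le.1 hu]
  have ha' : (a : ℝ) ≤ 1 := by exact_mod_cast ha
  have h1 : Set.Iic (a : ℝ) ∩ Set.Icc 0 1 = Set.Icc 0 (a : ℝ) := by
    ext u; simp only [Set.mem_inter_iff, Set.mem_Iic, Set.mem_Icc]
    constructor
    · rintro ⟨h1, h2, -⟩; exact ⟨h2, h1⟩
    · rintro ⟨h1, h2⟩; exact ⟨h2, h1, h2.trans ha'⟩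
  have h2 : Set.Ioi (a : ℝ) ∩ Set.Icc 0 1 = Set.Ioc (a : ℝ) 1 := by
    ext u; simp only [Set.mem_inter_iff, Set.mem_Ioi, Set.mem_Icc, Set.mem_Ioc]
    constructor
    · rintro ⟨h1, -, h2⟩; exact ⟨h1, h2⟩
    · rintro ⟨h1, h2⟩; exact ⟨h1, a.2.trans h1.le, h2⟩
  rw [h, lintegral_add_left (measurable_const.indicator measurableSet_Iic),
    lintegral_indicator_const measurableSet_Iic, lintegral_indicator_const measurableSet_Ioi,
    Measure.restrict_apply measurableSet_Iic, Measure.restrict_apply measurableSet_Ioi, h1, h2,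
    Real.volume_Icc, Real.volume_Ioc, sub_zero, ENNReal.ofReal_coe_nnreal,
    ENNReal.ofReal_sub 1 a.coe_nonneg, ENNReal.ofReal_one, ENNReal.ofReal_coe_nnreal, mul_comm F,
    mul_comm E]

namespace Model

variable {μ : ι → Measure C} (P : Model μ)

theorem dependsOn_interaction (D : Finset ι) (d : ι) (c : C) :
    DependsOn (P.interaction D d c) (P.queried D d c : Set ι) := by
  intro o o' h
  unfold interaction
  congr 1
  funext i
  by_cases hi : i.1 ∈ P.queried D d c
  · simp only [hi, if_true]
    rw [h i.1 hi]
  · simp only [hi, if_false]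

theorem measurable_interaction {D : Finset ι} {d : ι} (hd : d ∈ D) (c : C) :
    Measurable (P.interaction D d c) := by
  refine (P.measurable_w₁₂ D d hd).comp (measurable_pi_lambda _ fun i => ?_)
  by_cases hi : i.1 ∈ P.queried D d c
  · simp only [hi, if_true]
    exact (Measurable.sumElim measurable_id measurable_const).comp (measurable_pi_apply _)
  · simp only [hi, if_false]
    exact measurable_const

/-- The coordinates in the queried set indeed suffice to evaluate `w₁₂`. -/
theorem interaction_ofState {D : Finset ι} {d : ι} (c : C)
    (y : ↥(D.erase d) → C) :
    P.interaction D d c (Output.ofState y) = P.w₁₂ D d (glue c y) := by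
  have hdet := (determiningSet_isLeast D d (P.w₁₂ D d) c).1.2
  have hsub := determiningSet_subset D d (P.w₁₂ D d) c
  refine hdet _ _ (fun i hi => ?_) fun i hi => ?_
  · have : i.1 ∉ P.queried D d c := fun h => (Finset.mem_erase.1 (hsub h)).1 hi
    exact ⟨by simp only [this, if_false], by simp [glue, hi]⟩
  · have h' := Finset.mem_erase.1 (hsub hi)
    have : i.1 ∈ P.queried D d c := hi
    simp only [this, if_true]
    simp [Output.ofState, glue, h'.1]

/-- The unnormalized density `w₁(x(d)) · w_{D \ {d}}(x(D \ {d}))` of the proposals. -/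
def proposalWeight {D : Finset ι} {d : ι} (hd : d ∈ D) (x : D → C) : ℝ≥0∞ :=
  P.w₁ D d (x ⟨d, hd⟩)
    * P.w (D.erase d) (Finset.restrict₂ (π := fun _ => C) (Finset.erase_subset d D) x)

theorem measurable_proposalWeight {D : Finset ι} {d : ι} (hd : d ∈ D) :
    Measurable (P.proposalWeight hd) :=
  ((P.measurable_w₁ D d hd).comp (measurable_pi_apply _)).coe_nnreal_ennreal.mul
    ((P.measurable_w _).comp (Finset.measurable_restrict₂ _)).coe_nnreal_ennreal

theorem w_eq_proposalWeight_mul {D : Finset ι} {d : ι} (hd : d ∈ D) (x : D → C) :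
    (P.w D x : ℝ≥0∞) = P.proposalWeight hd x * P.w₁₂ D d x := by
  rw [P.factor D d hd x]
  simp [proposalWeight]

theorem lintegral_proposalWeight_mul [∀ i, IsFiniteMeasure (μ i)] {D : Finset ι} {d : ι}
    (hd : d ∈ D) {g : (D → C) → ℝ≥0∞} (hg : Measurable g) :
    ∫⁻ x, P.proposalWeight hd x * g x ∂(Measure.pi fun i : D => μ i)
      = ∫⁻ c, (P.w₁ D d c : ℝ≥0∞) * ∫⁻ y, (P.w (D.erase d) y : ℝ≥0∞) * g (glue c y)
          ∂(Measure.pi fun i : (D.erase d : Finset ι) => μ i) ∂(μ d) := by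
  rw [lintegral_pi_eq_lintegral_glue μ hd (g := fun x => P.proposalWeight hd x * g x)
    ((P.measurable_proposalWeight hd).mul hg)]
  refine lintegral_congr fun c => ?_
  rw [← lintegral_const_mul]
  · refine lintegral_congr fun y => ?_
    rw [proposalWeight, glue_self, restrict₂_glue, mul_assoc]
  · exact (P.measurable_w _).coe_nnreal_ennreal.mul
      (hg.comp (measurable_glue.comp measurable_prodMk_left))

theorem lintegral_proposalWeight [∀ i, IsFiniteMeasure (μ i)] {D : Finset ι} {d : ι}
    (hd : d ∈ D) :
    ∫⁻ x, P.proposalWeight hd x ∂(Measure.pi fun i : D => μ i)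
      = (∫⁻ c, (P.w₁ D d c : ℝ≥0∞) ∂(μ d)) * P.partitionFunction (D.erase d) := by
  have h := P.lintegral_proposalWeight_mul hd (g := fun _ => 1) measurable_const
  simp only [mul_one] at h
  rw [h, lintegral_mul_const _ (P.measurable_w₁ D d hd).coe_nnreal_ennreal]
  rfl

theorem partitionFunction_le [∀ i, IsFiniteMeasure (μ i)] {D : Finset ι} {d : ι} (hd : d ∈ D) :
    P.partitionFunction D
      ≤ (∫⁻ c, (P.w₁ D d c : ℝ≥0∞) ∂(μ d)) * P.partitionFunction (D.erase d) * P.M D d := by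
  rw [← P.lintegral_proposalWeight hd,
    ← lintegral_mul_const _ (P.measurable_proposalWeight hd)]
  refine lintegral_mono fun x => ?_
  rw [P.w_eq_proposalWeight_mul hd]
  gcongr
  exact P.le_M D d hd x

theorem partitionFunction_erase_ne_zero [∀ i, IsFiniteMeasure (μ i)] {D : Finset ι} {d : ι}
    (hd : d ∈ D) (hZ : P.partitionFunction D ≠ 0) : P.partitionFunction (D.erase d) ≠ 0 := by
  intro h
  have := P.partitionFunction_le hd
  simp [h, hZ] at this

theorem partitionFunction_ne_top [∀ i, IsFiniteMeasure (μ i)] (D : Finset ι) :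
    P.partitionFunction D ≠ ∞ := by
  induction D using Finset.strongInduction with
  | H D ih =>
    rcases D.eq_empty_or_nonempty with rfl | ⟨d, hd⟩
    · rw [partitionFunction, lintegral_unique]
      exact ENNReal.mul_ne_top ENNReal.coe_ne_top (measure_ne_top _ _)
    · exact ne_top_of_le_ne_top (ENNReal.mul_ne_top (ENNReal.mul_ne_top (P.w₁_ne_top D d hd)
        (ih _ (Finset.erase_ssubset hd))) ENNReal.coe_ne_top) (P.partitionFunction_le hd)

theorem isProbabilityMeasure_exactLaw [∀ i, IsFiniteMeasure (μ i)] {D : Finset ι}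
    (hZ : P.partitionFunction D ≠ 0) : IsProbabilityMeasure (P.exactLaw D) := by
  constructor
  rw [exactLaw, Measure.smul_apply, withDensity_apply _ MeasurableSet.univ,
    Measure.restrict_univ, smul_eq_mul]
  exact ENNReal.inv_mul_cancel hZ (P.partitionFunction_ne_top D)

theorem isProbabilityMeasure_drawLaw {D : Finset ι} {d : ι} (hd : d ∈ D) :
    IsProbabilityMeasure (P.drawLaw D d) := by
  constructor
  rw [drawLaw, Measure.smul_apply, withDensity_apply _ MeasurableSet.univ,
    Measure.restrict_univ, smul_eq_mul]
  exact ENNReal.inv_mul_cancel (P.w₁_ne_zero D d hd) (P.w₁_ne_top D d hd)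

theorem lintegral_exactLaw (D : Finset ι) {g : (D → C) → ℝ≥0∞} (hg : Measurable g) :
    ∫⁻ x, g x ∂(P.exactLaw D) = (P.partitionFunction D)⁻¹
      * ∫⁻ x, (P.w D x : ℝ≥0∞) * g x ∂(Measure.pi fun i : D => μ i) := by
  rw [exactLaw, lintegral_smul_measure, smul_eq_mul, lintegral_withDensity_eq_lintegral_mul _
    (P.measurable_w D).coe_nnreal_ennreal hg]
  rfl

theorem lintegral_drawLaw {D : Finset ι} {d : ι} (hd : d ∈ D) {g : C → ℝ≥0∞}
    (hg : Measurable g) :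
    ∫⁻ c, g c ∂(P.drawLaw D d) = (∫⁻ c, (P.w₁ D d c : ℝ≥0∞) ∂(μ d))⁻¹
      * ∫⁻ c, (P.w₁ D d c : ℝ≥0∞) * g c ∂(μ d) := by
  rw [drawLaw, lintegral_smul_measure, smul_eq_mul, lintegral_withDensity_eq_lintegral_mul _
    (P.measurable_w₁ D d hd).coe_nnreal_ennreal hg]
  rfl

/-- An independent pair of a draw from `w₁` and an exact draw on `D \ {d}` has the normalized
density `proposalWeight`. -/
theorem lintegral_drawLaw_exactLaw [∀ i, IsFiniteMeasure (μ i)] {D : Finset ι} {d : ι}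
    (hd : d ∈ D) (hZ : P.partitionFunction (D.erase d) ≠ 0) {g : (D → C) → ℝ≥0∞}
    (hg : Measurable g) :
    ∫⁻ c, ∫⁻ y, g (glue c y) ∂(P.exactLaw (D.erase d)) ∂(P.drawLaw D d)
      = ((∫⁻ c, (P.w₁ D d c : ℝ≥0∞) ∂(μ d)) * P.partitionFunction (D.erase d))⁻¹
        * ∫⁻ x, P.proposalWeight hd x * g x ∂(Measure.pi fun i : D => μ i) := by
  have := P.isProbabilityMeasure_exactLaw hZ
  have hgm := hg.comp ((measurable_glue (D := D) (d := d)))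
  have h1 : ∀ c, ∫⁻ y, g (glue c y) ∂(P.exactLaw (D.erase d))
      = (P.partitionFunction (D.erase d))⁻¹ * ∫⁻ y, (P.w (D.erase d) y : ℝ≥0∞) * g (glue c y)
          ∂(Measure.pi fun i : (D.erase d : Finset ι) => μ i) := fun c =>
    P.lintegral_exactLaw _ (hgm.comp measurable_prodMk_left)
  rw [P.lintegral_drawLaw hd (g := fun c => ∫⁻ y, g (glue c y) ∂(P.exactLaw (D.erase d)))
      (Measurable.lintegral_prod_right' hgm),
    P.lintegral_proposalWeight_mul hd hg,
    ENNReal.mul_inv (Or.inl (P.w₁_ne_zero D d hd)) (Or.inl (P.w₁_ne_top D d hd)), mul_assoc,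
    ← lintegral_const_mul' _ _ (ENNReal.inv_ne_top.2 hZ)]
  congr 1
  refine lintegral_congr fun c => ?_
  rw [h1]
  ring

/-- The fixed point equation of rejection sampling: accept a proposal `x` with probability
`w₁₂(x) / M`, and otherwise draw anew from the target. The result is a draw from the target. -/
theorem lintegral_accept_add_reject [∀ i, IsFiniteMeasure (μ i)] {D : Finset ι} {d : ι}
    (hd : d ∈ D) (hZ : P.partitionFunction D ≠ 0) {g : (D → C) → ℝ≥0∞} (hg : Measurable g) :
    ∫⁻ c, ∫⁻ y, (((P.w₁₂ D d (glue c y) / P.M D d : ℝ≥0) : ℝ≥0∞) * g (glue c y)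
        + (1 - ((P.w₁₂ D d (glue c y) / P.M D d : ℝ≥0) : ℝ≥0∞)) * ∫⁻ x, g x ∂(P.exactLaw D))
        ∂(P.exactLaw (D.erase d)) ∂(P.drawLaw D d)
      = ∫⁻ x, g x ∂(P.exactLaw D) := by
  have hZ' := P.partitionFunction_erase_ne_zero hd hZ
  have hpE := P.isProbabilityMeasure_exactLaw hZ'
  have hpD := P.isProbabilityMeasure_drawLaw hd
  set E := ∫⁻ x, g x ∂(P.exactLaw D) with hE
  let a : (D → C) → ℝ≥0∞ := fun x => ((P.w₁₂ D d x / P.M D d : ℝ≥0) : ℝ≥0∞)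
  have ha : Measurable a := ((P.measurable_w₁₂ D d hd).div_const _).coe_nnreal_ennreal
  have ha1 : ∀ x, a x ≤ 1 := fun x => by
    have h : P.w₁₂ D d x / P.M D d ≤ 1 := div_le_one_of_le₀ (P.le_M D d hd x) zero_le
    exact ENNReal.coe_le_one_iff.2 h
  have hna : Measurable fun x => 1 - a x := measurable_const.sub ha
  let J : ((D → C) → ℝ≥0∞) → ℝ≥0∞ := fun h =>
    ∫⁻ c, ∫⁻ y, h (glue c y) ∂(P.exactLaw (D.erase d)) ∂(P.drawLaw D d)
  have hJ : ∀ h : (D → C) → ℝ≥0∞, Measurable h → J h = _ := fun h hh =>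
    P.lintegral_drawLaw_exactLaw hd hZ' hh
  have hJadd : ∀ h k : (D → C) → ℝ≥0∞, Measurable h → Measurable k →
      J (fun x => h x + k x) = J h + J k := by
    intro h k hh hk
    rw [hJ (fun x => h x + k x) (hh.add hk), hJ _ hh, hJ _ hk]
    simp only [mul_add]
    rw [lintegral_add_left (f := fun x => P.proposalWeight hd x * h x)
      ((P.measurable_proposalWeight hd).mul hh), mul_add]
  have hJE : J (fun x => (1 - a x) * E) = J (fun x => 1 - a x) * E := by
    rw [hJ _ (hna.mul_const E), hJ _ hna]
    simp only [← mul_assoc]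
    rw [lintegral_mul_const (f := fun x => P.proposalWeight hd x * (1 - a x)) _
      ((P.measurable_proposalWeight hd).mul hna), mul_assoc]
  -- accepted proposals have density proportional to `w D`
  have hJa : ∀ h : (D → C) → ℝ≥0∞, Measurable h →
      J (fun x => a x * h x)
        = ((∫⁻ c, (P.w₁ D d c : ℝ≥0∞) ∂(μ d)) * P.partitionFunction (D.erase d))⁻¹
          * ((P.M D d : ℝ≥0∞)⁻¹ * P.partitionFunction D)
          * ∫⁻ x, h x ∂(P.exactLaw D) := by
    intro h hh
    have hM : (P.M D d : ℝ≥0∞) ≠ 0 := by exact_mod_cast (P.M_pos D d hd).ne'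
    rw [hJ (fun x => a x * h x) (ha.mul hh), P.lintegral_exactLaw D hh, mul_assoc, mul_assoc,
      ← mul_assoc (P.partitionFunction D), ENNReal.mul_inv_cancel hZ (P.partitionFunction_ne_top D),
      one_mul, ← lintegral_const_mul' _ _ (ENNReal.inv_ne_top.2 hM)]
    congr 1
    refine lintegral_congr fun x => ?_
    rw [P.w_eq_proposalWeight_mul hd]
    simp only [a]
    rw [ENNReal.coe_div (P.M_pos D d hd).ne', ENNReal.div_eq_inv_mul]
    ring
  have hprob := P.isProbabilityMeasure_exactLaw hZ
  have hJaE : J (fun x => a x * g x) = J a * E := by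
    have h1 := hJa (fun _ => 1) measurable_const
    simp only [mul_one, lintegral_one, measure_univ] at h1
    rw [hJa g hg, ← hE, ← h1]
  have hJ1 : J a + J (fun x => 1 - a x) = 1 := by
    rw [← hJadd _ _ ha hna]
    simp only [add_tsub_cancel_of_le (ha1 _), J, lintegral_one, measure_univ]
  calc _ = J (fun x => a x * g x + (1 - a x) * E) := rfl
    _ = J (fun x => a x * g x) + J (fun x => (1 - a x) * E) :=
      hJadd _ _ (ha.mul hg) (hna.mul_const E)
    _ = E := by rw [hJE, hJaE, ← add_mul, hJ1, one_mul]

/-! ### The truncated procedure -/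

/-- However early the recursion is cut off, the coordinates in `S` of the output are dominated by
those of an exact draw. Since `Measure.lintegral_bind_le` and `lintegral_map_le` are
inequalities that hold for all functions, no measurability of the steps of the procedure is
needed. -/
theorem lintegral_law_le [∀ i, IsFiniteMeasure (μ i)] (sel : Finset ι → Finset ι → ι)
    (hsel : ∀ S D : Finset ι, S.Nonempty → sel S D ∈ S) (n : ℕ) {S D : Finset ι} (hSD : S ⊆ D)
    (hZ : P.partitionFunction D ≠ 0) {f : Output ι C → ℝ≥0∞} (hf : Measurable f)
    (hfS : DependsOn f (S : Set ι)) :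
    ∫⁻ o, f o ∂(P.law sel n S D) ≤ ∫⁻ x, f (Output.ofState x) ∂(P.exactLaw D) := by
  induction n generalizing S D f with
  | zero => simp [law]
  | succ n ih =>
    have hprob := P.isProbabilityMeasure_exactLaw hZ
    rw [law]
    split_ifs with hS
    · subst hS
      rw [lintegral_dirac' _ hf]
      have h : ∀ x : D → C, f (Output.ofState x) = f Output.empty := fun x => hfS (by simp)
      simp [h]
    have hdS := hsel S D (Finset.nonempty_iff_ne_empty.2 hS)
    generalize sel S D = d at hdS
    have hd := hSD hdS
    have hZ' := P.partitionFunction_erase_ne_zero hd hZ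
    have hprob' := P.isProbabilityMeasure_exactLaw hZ'
    have hg : Measurable fun x : D → C => f (Output.ofState x) := hf.comp Output.measurable_ofState
    set E := ∫⁻ x, f (Output.ofState x) ∂(P.exactLaw D) with hE
    have hErase : S.erase d ⊆ D.erase d := Finset.erase_subset_erase d hSD
    -- after `X(d) = c` is recorded, the remaining coordinates in `S` determine `f`
    have hrec : ∀ c, DependsOn (fun o => f (Output.record d c o)) (S.erase d : Set ι) := by
      intro c o o' h
      refine hfS fun i hi => ?_
      by_cases hid : i = d
      · simp [Output.record, hid]
      · simpa [Output.record, hid] using h i (by simpa [hid] using hi)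
    -- recursive calls are replaced by exact draws; by `minGiven_le`, an immediate acceptance is
    -- also an acceptance after the query
    have hstep : ∀ c (u : ℝ),
        ∫⁻ o, f o ∂(if u ≤ (minGiven D d (P.w₁₂ D d) c / P.M D d : ℝ≥0) then
            (P.law sel n (S.erase d) (D.erase d)).map (Output.record d c)
          else
            (P.law sel n (S.erase d ∪ P.queried D d c) (D.erase d)).bind fun o =>
              if u ≤ (P.interaction D d c o / P.M D d : ℝ≥0) then
                Measure.dirac (Output.record d c o)
              else P.law sel n S D)
        ≤ ∫⁻ y, (if u ≤ (P.w₁₂ D d (glue c y) / P.M D d : ℝ≥0) then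
            f (Output.ofState (glue c y : D → C)) else E) ∂(P.exactLaw (D.erase d)) := by
      intro c u
      split_ifs with hu
      · refine (lintegral_map_le _ _).trans ((ih hErase hZ'
          (hf.comp (Output.measurable_record d c)) (hrec c)).trans_eq ?_)
        refine lintegral_congr fun y => ?_
        have hle := minGiven_le hd (P.w₁₂ D d) (glue c y)
        rw [glue_self] at hle
        have hle' : (minGiven D d (P.w₁₂ D d) c / P.M D d : ℝ≥0)
          ≤ P.w₁₂ D d (glue c y) / P.M D d := by gcongr
        rw [if_pos (hu.trans (by exact_mod_cast hle')), Output.ofState_glue hd]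
        rfl
      · let k : Output ι C → ℝ≥0∞ := fun o =>
          if u ≤ (P.interaction D d c o / P.M D d : ℝ≥0) then f (Output.record d c o) else E
        have hk : Measurable k := by
          refine Measurable.ite ?_ (hf.comp (Output.measurable_record d c)) measurable_const
          exact measurableSet_le measurable_const
            ((P.measurable_interaction hd c).div_const _).coe_nnreal_real
        have hkS : DependsOn k ((S.erase d ∪ P.queried D d c : Finset ι) : Set ι) := by
          intro o o' h
          have h1 : P.interaction D d c o = P.interaction D d c o' :=
            P.dependsOn_interaction D d c fun i hi => h i (by simp_all)
          have h2 : f (Output.record d c o) = f (Output.record d c o') :=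
            hrec c fun i hi => h i (by simp_all)
          simp only [k, h1, h2]
        refine (Measure.lintegral_bind_le _ _ _).trans ((lintegral_mono fun o => ?_).trans
          ((ih (Finset.union_subset hErase (determiningSet_subset _ _ _ _)) hZ' hk hkS).trans_eq ?_))
        · change _ ≤ k o
          simp only [k]
          split_ifs
          · rw [lintegral_dirac' _ hf]
          · exact ih hSD hZ hf hfS
        · refine lintegral_congr fun y => ?_
          simp only [k]
          rw [P.interaction_ofState, Output.ofState_glue hd]
    refine (Measure.lintegral_bind_le _ _ _).trans (le_trans (lintegral_mono fun c => ?_)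
      (P.lintegral_accept_add_reject hd hZ hg).le)
    refine (Measure.lintegral_bind_le _ _ _).trans ((lintegral_mono fun u => hstep c u).trans_eq ?_)
    have hglue : Measurable fun y : ↥(D.erase d) → C => (glue c y : D → C) :=
      measurable_glue.comp measurable_prodMk_left
    rw [lintegral_lintegral_swap]
    · refine lintegral_congr fun y => ?_
      exact lintegral_uniform_ite (div_le_one_of_le₀ (P.le_M D d hd _) zero_le) _ _
    · refine (Measurable.ite ?_ ((hg.comp hglue).comp measurable_snd) measurable_const).aemeasurable
      exact measurableSet_le measurable_fst
        ((((P.measurable_w₁₂ D d hd).comp hglue).div_const _).coe_nnreal_real.comp measurable_snd)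

/-- The bound `lintegral_law_le` for the event that an output lies in a measurable set. -/
theorem law_apply_le [∀ i, IsFiniteMeasure (μ i)] (sel : Finset ι → Finset ι → ι)
    (hsel : ∀ S D : Finset ι, S.Nonempty → sel S D ∈ S) (n : ℕ) {S D : Finset ι} (hSD : S ⊆ D)
    (hZ : P.partitionFunction D ≠ 0) {A : Set (Output ι C)} (hA : MeasurableSet A)
    (hAS : DependsOn (fun o => o ∈ A) (S : Set ι)) :
    P.law sel n S D A ≤ P.exactLaw D (Output.ofState ⁻¹' A) := by
  classical
  have h := P.lintegral_law_le sel hsel n hSD hZ (f := A.indicator 1)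
    (measurable_one.indicator hA) (fun o o' h => by
      have : (o ∈ A) = (o' ∈ A) := hAS h
      simp [Set.indicator_apply, this])
  rw [lintegral_indicator_one hA] at h
  refine h.trans_eq ?_
  rw [← lintegral_indicator_one (Output.measurable_ofState hA)]
  rfl

end Model

end PRAR

end

theorem lemma2 {ι C : Type*} [DecidableEq ι] [MeasurableSpace C]
    (μ : ι → MeasureTheory.Measure C) [∀ i, MeasureTheory.IsFiniteMeasure (μ i)]
    (P : PRAR.Model μ)
    (sel : Finset ι → Finset ι → ι) (hsel : ∀ S D : Finset ι, S.Nonempty → sel S D ∈ S)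
    (S D : Finset ι) (hSD : S ⊆ D)
    (hZ : P.partitionFunction D ≠ 0)
    (hterm : P.TerminatesAS sel S D) :
    ∀ B : Set (S → C), MeasurableSet B →
      P.outputProb sel S D {o | ∃ x ∈ B, ∀ s : S, o s = Sum.inl (x s)}
        = P.exactLaw D {x | Finset.restrict₂ (π := fun _ => C) hSD x ∈ B} := by
  intro B hB
  have hprob := P.isProbabilityMeasure_exactLaw hZ
  have hA := PRAR.measurableSet_reported (ι := ι) hB
  have hpre : {x : D → C | Finset.restrict₂ (π := fun _ => C) hSD x ∈ B}
      = PRAR.Output.ofState ⁻¹' (PRAR.reported B : Set (PRAR.Output ι C)) :=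
    Set.ext fun x => (PRAR.ofState_mem_reported hSD B x).symm
  rw [hpre]
  change P.outputProb sel S D (PRAR.reported B) = _
  have hle := fun n => P.law_apply_le sel hsel n hSD hZ hA (PRAR.dependsOn_reported B)
  refine le_antisymm (iSup_le hle) ?_
  -- the complementary event is dominated as well, and the total masses agree
  have hcompl := fun n => P.law_apply_le sel hsel n hSD hZ hA.compl
    (fun o o' h => congrArg Not (PRAR.dependsOn_reported B h))
  have htotal : (1 : ℝ≥0∞) ≤ P.outputProb sel S D (PRAR.reported B)
      + P.exactLaw D (PRAR.Output.ofState ⁻¹' (PRAR.reported B)ᶜ) := by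
    rw [← hterm]
    refine iSup_le fun n => ?_
    rw [← measure_add_measure_compl hA]
    exact add_le_add (le_iSup (fun n => P.law sel n S D (PRAR.reported B)) n) (hcompl n)
  rw [← prob_add_prob_compl (μ := P.exactLaw D) (PRAR.Output.measurable_ofState hA),
    ← Set.preimage_compl] at htotal
  exact (ENNReal.add_le_add_iff_right (measure_ne_top _ _)).1 htotal
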